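/- Let $E$ be a Hausdorff locally convex topological vector space over $\mathbb{R}$ and let $M$ be a manifold modelled on $E$, smoothness being understood in the sense that smooth curves are mapped to smooth curves. Let $\theta\in\Omega^1(M)$ be a smooth 1-form and $\omega\in\Omega^2(M)$ a smooth 2-form, and assume that $\omega$ is degenerate, i.e. $\ker\omega_x=\{v\in T_xM : \omega_x(v,\cdot)=0\}\neq\{0\}$ for every $x\in M$. Write $\mathrm{Hor}=\ker\theta$ and $\mathrm{Ver}=\ker\omega$. Then the following are equivalent: 1. $TM=\mathrm{Hor}\oplus\mathrm{Ver}$, i.e. $T_xM=\ker\theta_x\oplus\ker\omega_x$ for every $x\in M$; 2. $\omega|_{\mathrm{Hor}}$ is weakly non-degenerate, i.e. for every $x\in M$ and $v\in\ker\theta_x$, if $\omega_x(v,w)=0$ for all $w\in\ker\theta_x$, then $v=0$; 3. the bundle homomorphism $\flat_{\theta,\omega}\colon TM\to T'M$, $v\mapsto \iota_v\omega+\theta(v)\theta$, is injective, where $T'M$ is the bundle of continuous linear functionals on the tangent spaces. The induced $C^\infty(M)$-linear map $X\mapsto\iota_X\omega+\theta(X)\theta$ takes smooth vector fields to smooth 1-forms,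 and if (3) holds then it is injective on smooth vector fields. A pair $(\theta,\omega)$ with $\omega$ degenerate that satisfies (1) is called an almost contact structure, and $(M,\theta,\omega)$ is called a cosymplectic manifold if moreover $d\theta=0$ and $d\omega=0$. Thus, if $\theta$ and $\omega$ are closed, then each of (1)–(3) holds if and only if $(M,\theta,\omega)$ is a cosymplectic manifold. -/

import Mathlib

open Set Filter Topology

noncomputable section

namespace LCGeometry

/-! ### Curves in a locally convex space -/

section Curves

variable {E : Type*} [AddCommGroup E] [Module ℝ E] [TopologicalSpace E]

/-- The curve `c` has derivative `v` at the time `t`, as a limit of difference quotients. -/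
def HasVelocityAt (c : ℝ → E) (v : E) (t : ℝ) : Prop :=
  Tendsto (fun δ : ℝ => δ⁻¹ • (c (t + δ) - c t)) (𝓝[≠] 0) (𝓝 v)

/-- The derivative of the curve `c` at the time `t` (meaningful where the limit exists). -/
def velocity (c : ℝ → E) (t : ℝ) : E :=
  limUnder (𝓝[≠] (0 : ℝ)) (fun δ : ℝ => δ⁻¹ • (c (t + δ) - c t))

/-- The curve `c` is smooth on the open set `J` of times: all iterated derivatives `d n` exist and
are continuous. -/
def SmoothCurveOn (c : ℝ → E) (J : Set ℝ) : Prop :=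
  ∃ d : ℕ → ℝ → E, (∀ t ∈ J, d 0 t = c t) ∧
    ∀ n, ContinuousOn (d n) J ∧ ∀ t ∈ J, HasVelocityAt (d n) (d (n + 1) t) t

/-- Smoothness of a map on the open set `U`, in the sense of the convenient calculus: smooth curves
in `U` are mapped to smooth curves. -/
def SmoothMapOn (f : E → E) (U : Set E) : Prop :=
  ∀ c : ℝ → E, SmoothCurveOn c univ → (∀ t, c t ∈ U) → SmoothCurveOn (fun t => f (c t)) univ

end Curves

/-! ### Manifolds modelled on a locally convex space -/

/-- `M`, with the charts of its `ChartedSpace` structure, is a smooth manifold modelled on the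
topological vector space `E`: the transition maps are smooth where they are defined. -/
class IsSmoothManifold (E : Type*) [AddCommGroup E] [Module ℝ E] [TopologicalSpace E]
    (M : Type*) [TopologicalSpace M] [ChartedSpace E M] : Prop where
  compatible : ∀ e ∈ atlas E M, ∀ e' ∈ atlas E M,
    SmoothMapOn (fun y => e' (e.symm y)) (e.symm.trans e').source

/-- The tangent space at `x`: the model space, a tangent vector being represented by its
coordinates in the preferred chart `chartAt E x` (the same convention as Mathlib's
`TangentSpace`, which is only available for normed model spaces). -/
abbrev TSpace (E : Type*) {M : Type*} (_x : M) : Type _ := E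

/-- The cotangent space at `x`: continuous linear functionals on the tangent space. -/
abbrev CoTSpace (E : Type*) [AddCommGroup E] [Module ℝ E] [TopologicalSpace E]
    {M : Type*} (x : M) : Type _ := TSpace E x →L[ℝ] ℝ

/-- The (total space of the) kinematic tangent bundle. -/
abbrev TBundle (E : Type*) (M : Type*) : Type _ := (x : M) × TSpace E x

/-- The (total space of the) kinematic cotangent bundle. -/
abbrev CoTBundle (E : Type*) [AddCommGroup E] [Module ℝ E] [TopologicalSpace E]
    (M : Type*) : Type _ := (x : M) × CoTSpace E x

section Manifold

open scoped ContDiff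

variable (E : Type*) [AddCommGroup E] [Module ℝ E] [TopologicalSpace E]
variable {M : Type*} [TopologicalSpace M]

variable {E} in
/-- The differential of the coordinate change `e' ∘ e⁻¹` at the point `y`, applied to `v`. -/
def coordChange (e e' : OpenPartialHomeomorph M E) (y v : E) : E :=
  velocity (fun t : ℝ => e' (e.symm (y + t • v))) 0

variable [ChartedSpace E M]

variable {E} in
/-- The coordinates, in the chart `e`, of the tangent vector `v` at `x`. -/
def tangentCoord (e : OpenPartialHomeomorph M E) (x : M) (v : TSpace E x) : E :=
  coordChange (chartAt E x) e (chartAt E x x) v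

variable {E} in
/-- The tangent vector at `e⁻¹ y` whose coordinates in the chart `e` are `v`. -/
def tangentOfCoord (e : OpenPartialHomeomorph M E) (y v : E) : TSpace E (e.symm y) :=
  coordChange e (chartAt E (e.symm y)) y v

/-- Smooth curves in `M`: continuous, and smooth in every chart wherever this makes sense. -/
def IsSmoothPath (c : ℝ → M) : Prop :=
  Continuous c ∧ ∀ e ∈ atlas E M, SmoothCurveOn (fun t => e (c t)) (c ⁻¹' e.source)

/-- Smooth curves in the tangent bundle, as a base curve `c` and a vector `V t` at each `c t`. -/
def IsSmoothTangentPath (c : ℝ → M) (V : ∀ t, TSpace E (c t)) : Prop :=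
  IsSmoothPath E c ∧
    ∀ e ∈ atlas E M, SmoothCurveOn (fun t => tangentCoord e (c t) (V t)) (c ⁻¹' e.source)

variable (M) in
/-- The algebra of smooth functions on `M`: they map smooth curves to smooth curves. -/
def smoothFunctions : Subalgebra ℝ (M → ℝ) where
  carrier := {f | ∀ c : ℝ → M, IsSmoothPath E c → ContDiff ℝ ∞ (fun t => f (c t))}
  mul_mem' hf hg c hc := (hf c hc).mul (hg c hc)
  add_mem' hf hg c hc := (hf c hc).add (hg c hc)
  algebraMap_mem' _ _ _ := contDiff_const

/-- A section `X` of the tangent bundle is a (smooth, kinematic) vector field if it maps smooth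
curves in `M` to smooth curves in the tangent bundle. -/
def IsVectorField (X : ∀ x : M, TSpace E x) : Prop :=
  ∀ c : ℝ → M, IsSmoothPath E c → IsSmoothTangentPath E c (fun t => X (c t))

/-- A section `α` of the cotangent bundle is a smooth `1`-form if it is smooth as a function on the
tangent bundle. -/
def IsOneForm (α : ∀ x : M, CoTSpace E x) : Prop :=
  ∀ (c : ℝ → M) (V : ∀ t, TSpace E (c t)), IsSmoothTangentPath E c V →
    ContDiff ℝ ∞ (fun t => α (c t) (V t))

variable (M)

/-- Smooth `1`-forms on `M`. -/
structure OneForm where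
  toFun : ∀ x : M, CoTSpace E x
  smooth' : IsOneForm E toFun

/-- Smooth `2`-forms on `M`: in each fibre an alternating bilinear form, continuous in each
variable (in the first one by antisymmetry), which is smooth as a function on the fibre product
`TM ×_M TM`. -/
structure TwoForm where
  toFun : ∀ x : M, TSpace E x →ₗ[ℝ] CoTSpace E x
  alternating' : ∀ (x : M) (v : TSpace E x), toFun x v v = 0
  smooth' : ∀ (c : ℝ → M) (V W : ∀ t, TSpace E (c t)),
    IsSmoothTangentPath E c V → IsSmoothTangentPath E c W →
      ContDiff ℝ ∞ (fun t => toFun (c t) (V t) (W t))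

end Manifold

/-! ### Almost contact and cosymplectic structures -/

section Structures

variable {E : Type*} [AddCommGroup E] [Module ℝ E] [TopologicalSpace E]
variable {M : Type*} [TopologicalSpace M] [ChartedSpace E M]

/-- `Hor = ker θ` at the point `x`. -/
def horizontal (θ : OneForm E M) (x : M) : Submodule ℝ (TSpace E x) :=
  LinearMap.ker (θ.toFun x : TSpace E x →ₗ[ℝ] ℝ)

/-- `Ver = ker ω` at the point `x`: the kernel of `v ↦ ω_x(v, ·)`. -/
def vertical (ω : TwoForm E M) (x : M) : Submodule ℝ (TSpace E x) :=
  LinearMap.ker (ω.toFun x)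

/-- `ω` is degenerate: its kernel is non-zero, at every point. -/
def TwoForm.IsDegenerate (ω : TwoForm E M) : Prop :=
  ∀ x : M, vertical ω x ≠ ⊥

/-- The restriction of `ω` to the distribution `H` is weakly non-degenerate in every fibre. -/
def TwoForm.WeaklyNondegenerateOn (ω : TwoForm E M) (H : ∀ x : M, Submodule ℝ (TSpace E x)) :
    Prop :=
  ∀ (x : M), ∀ v ∈ H x, (∀ w ∈ H x, ω.toFun x v w = 0) → v = 0

/-- `TM = Hor ⊕ Ver`, fibre by fibre. -/
def Splits (θ : OneForm E M) (ω : TwoForm E M) : Prop :=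
  ∀ x : M, IsCompl (horizontal θ x) (vertical ω x)

variable [IsTopologicalAddGroup E] [ContinuousSMul ℝ E]

/-- The map `v ↦ ι_v ω + θ(v) θ` in the fibre at `x`. -/
def flat (θ : OneForm E M) (ω : TwoForm E M) (x : M) : TSpace E x →ₗ[ℝ] CoTSpace E x :=
  ω.toFun x + (θ.toFun x : TSpace E x →ₗ[ℝ] ℝ).smulRight (θ.toFun x)

/-- The bundle map `v ↦ ι_v ω + θ(v) θ` from the tangent to the cotangent bundle. -/
def flatBundle (θ : OneForm E M) (ω : TwoForm E M) : TBundle E M → CoTBundle E M :=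
  fun p => ⟨p.1, flat θ ω p.1 p.2⟩

/-- The map `X ↦ ι_X ω + θ(X) θ` on sections, as a linear map over the algebra of smooth
functions. -/
def flatSections (θ : OneForm E M) (ω : TwoForm E M) :
    (∀ x : M, TSpace E x) →ₗ[smoothFunctions E M] (∀ x : M, CoTSpace E x) where
  toFun X x := flat θ ω x (X x)
  map_add' X Y := by
    funext x
    exact map_add (flat θ ω x) (X x) (Y x)
  map_smul' f X := by
    funext x
    exact map_smul (flat θ ω x) ((f : M → ℝ) x) (X x)

/-- The `1`-form `θ` in the chart `e`. -/
def OneForm.inChart (θ : OneForm E M) (e : OpenPartialHomeomorph M E) (y v : E) : ℝ :=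
  θ.toFun (e.symm y) (tangentOfCoord e y v)

/-- The `2`-form `ω` in the chart `e`. -/
def TwoForm.inChart (ω : TwoForm E M) (e : OpenPartialHomeomorph M E) (y v w : E) : ℝ :=
  ω.toFun (e.symm y) (tangentOfCoord e y v) (tangentOfCoord e y w)

/-- `dθ`, in the chart `e`. -/
def OneForm.extDeriv (θ : OneForm E M) (e : OpenPartialHomeomorph M E) (y v w : E) : ℝ :=
  lineDeriv ℝ (fun z => θ.inChart e z w) y v - lineDeriv ℝ (fun z => θ.inChart e z v) y w

/-- `dω`, in the chart `e`. -/
def TwoForm.extDeriv (ω : TwoForm E M) (e : OpenPartialHomeomorph M E) (y u v w : E) : ℝ :=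
  lineDeriv ℝ (fun z => ω.inChart e z v w) y u - lineDeriv ℝ (fun z => ω.inChart e z u w) y v
    + lineDeriv ℝ (fun z => ω.inChart e z u v) y w

/-- `dθ = 0`. -/
def OneForm.Closed (θ : OneForm E M) : Prop :=
  ∀ e ∈ atlas E M, ∀ y ∈ e.target, ∀ v w : E, θ.extDeriv e y v w = 0

/-- `dω = 0`. -/
def TwoForm.Closed (ω : TwoForm E M) : Prop :=
  ∀ e ∈ atlas E M, ∀ y ∈ e.target, ∀ u v w : E, ω.extDeriv e y u v w = 0

/-- `(θ, ω)` is an almost contact structure. -/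
structure IsAlmostContact (θ : OneForm E M) (ω : TwoForm E M) : Prop where
  degenerate : ω.IsDegenerate
  splits : Splits θ ω

/-- `(M, θ, ω)` is a cosymplectic manifold. -/
structure IsCosymplectic (θ : OneForm E M) (ω : TwoForm E M) : Prop where
  almostContact : IsAlmostContact θ ω
  closed_one : θ.Closed
  closed_two : ω.Closed

end Structures

end LCGeometry

end

namespace LCGeometry

section

variable {E : Type*} [AddCommGroup E] [Module ℝ E] [TopologicalSpace E]
variable {M : Type*} [TopologicalSpace M] [ChartedSpace E M]

/-! The equivalence is linear algebra in each fibre: under degeneracy all three conditions say that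
`Hor ∩ Ver = 0`. Since `Hor` is the kernel of one functional and `Ver ≠ 0`, trivial intersection
already forces a direct sum (`isCompl_of_disjoint`). Pairing `ι_v ω + θ(v)θ` with `v` leaves
`θ(v)²`, so the kernel of the flat map is exactly `Hor ∩ Ver` (`ker_flat`). Smoothness enters only
in showing that vector fields go to 1-forms. -/

theorem TwoForm.apply_swap (ω : TwoForm E M) (x : M) (v w : TSpace E x) :
    ω.toFun x v w = -ω.toFun x w v := by
  have h := ω.alternating' x (v + w)
  simp only [map_add, add_apply, ω.alternating' x v, ω.alternating' x w,
    zero_add, add_zero] at h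
  linarith

theorem mem_horizontal {θ : OneForm E M} {x : M} {v : TSpace E x} :
    v ∈ horizontal θ x ↔ θ.toFun x v = 0 :=
  Iff.rfl

theorem mem_vertical {ω : TwoForm E M} {x : M} {v : TSpace E x} :
    v ∈ vertical ω x ↔ ω.toFun x v = 0 :=
  Iff.rfl

/-- The horizontal space has codimension at most one, so a non-zero vertical space is complementary
to it as soon as the two are disjoint. -/
theorem isCompl_of_disjoint {θ : OneForm E M} {ω : TwoForm E M} {x : M}
    (hω : vertical ω x ≠ ⊥) (h : ∀ v ∈ horizontal θ x, v ∈ vertical ω x → v = 0) :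
    IsCompl (horizontal θ x) (vertical ω x) := by
  refine ⟨Submodule.disjoint_def.2 h, codisjoint_iff.2 (Submodule.eq_top_iff'.2 fun v => ?_)⟩
  obtain ⟨u, hu, hu0⟩ := Submodule.exists_mem_ne_zero_of_ne_bot hω
  have hθu : θ.toFun x u ≠ 0 := fun h0 => hu0 (h u h0 hu)
  -- The coefficient is the one that makes `θ` vanish on the difference: this is the projection onto
  -- `ker θ` along `u`.
  refine Submodule.mem_sup.2 ⟨v - (θ.toFun x v / θ.toFun x u) • u, ?_,
    (θ.toFun x v / θ.toFun x u) • u, Submodule.smul_mem _ _ hu, sub_add_cancel _ _⟩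
  rw [mem_horizontal, map_sub, map_smul, smul_eq_mul, div_mul_cancel₀ _ hθu, sub_self]

/-- `Ver` pairs to zero with everything, so once `Hor` and `Ver` span, a vector orthogonal to `Hor`
is orthogonal to the whole fibre, hence vertical. Conversely, a vector in `Hor ∩ Ver` is orthogonal
to `Hor`. -/
theorem splits_iff_weaklyNondegenerateOn {θ : OneForm E M} {ω : TwoForm E M}
    (hω : ω.IsDegenerate) : Splits θ ω ↔ ω.WeaklyNondegenerateOn (horizontal θ) := by
  refine ⟨fun h x v hv hvw => ?_, fun h x => isCompl_of_disjoint (hω x) fun v hv hv' => ?_⟩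
  · refine Submodule.disjoint_def.1 (h x).disjoint v hv (mem_vertical.2 ?_)
    ext w
    obtain ⟨a, ha, b, hb, rfl⟩ :=
      Submodule.mem_sup.1 ((h x).sup_eq_top ▸ Submodule.mem_top (x := w))
    rw [map_add, hvw a ha, ω.apply_swap x v b, mem_vertical.1 hb]
    simp
  · exact h x v hv fun w _ => by rw [mem_vertical.1 hv', zero_apply]

theorem flat_apply (θ : OneForm E M) (ω : TwoForm E M) (x : M) (v w : TSpace E x) :
    flat θ ω x v w = ω.toFun x v w + θ.toFun x v * θ.toFun x w :=
  rfl

/-- Degeneracy plays no role here; the alternating property of `ω` suffices. -/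
theorem ker_flat (θ : OneForm E M) (ω : TwoForm E M) (x : M) :
    LinearMap.ker (flat θ ω x) = horizontal θ x ⊓ vertical ω x := by
  ext v
  rw [LinearMap.mem_ker, Submodule.mem_inf, mem_horizontal, mem_vertical]
  constructor
  · intro h
    have hflat (w : TSpace E x) : ω.toFun x v w + θ.toFun x v * θ.toFun x w = 0 := by
      rw [← flat_apply, h, zero_apply]
    have hv : θ.toFun x v = 0 := by
      -- On the diagonal the `ω` term drops out and `θ(v)² = 0` remains.
      have := hflat v
      rwa [ω.alternating', zero_add, mul_self_eq_zero] at this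
    refine ⟨hv, ?_⟩
    ext w
    simpa [hv] using hflat w
  · rintro ⟨h₁, h₂⟩
    ext w
    simp [flat_apply, h₁, h₂]

theorem flatBundle_injective_iff {θ : OneForm E M} {ω : TwoForm E M} :
    Function.Injective (flatBundle θ ω) ↔ ∀ x, Function.Injective (flat θ ω x) := by
  constructor
  · intro h x v w hvw
    have : (⟨x, v⟩ : TBundle E M) = ⟨x, w⟩ := h (Sigma.ext rfl (heq_of_eq hvw))
    exact eq_of_heq (Sigma.mk.inj this).2
  · rintro h ⟨x, v⟩ ⟨y, w⟩ hvw
    obtain ⟨rfl, hvw⟩ := Sigma.mk.inj hvw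
    exact Sigma.ext rfl (heq_of_eq (h x (eq_of_heq hvw)))

theorem splits_iff_flatBundle_injective {θ : OneForm E M} {ω : TwoForm E M}
    (hω : ω.IsDegenerate) : Splits θ ω ↔ Function.Injective (flatBundle θ ω) := by
  rw [flatBundle_injective_iff]
  refine forall_congr' fun x => ?_
  rw [← LinearMap.ker_eq_bot, ker_flat, ← disjoint_iff]
  exact ⟨IsCompl.disjoint, fun h => isCompl_of_disjoint (hω x) (Submodule.disjoint_def.1 h)⟩

/-- Along a smooth tangent path `V` over `c`, the field gives a second smooth tangent path `X ∘ c`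
over the same base, so `ω(X, V)` and `θ(X)θ(V)` are smooth in time. -/
theorem isOneForm_flatSections (θ : OneForm E M) (ω : TwoForm E M) {X : ∀ x : M, TSpace E x}
    (hX : IsVectorField E X) : IsOneForm E (flatSections θ ω X) := fun c V hV =>
  (ω.smooth' c _ V (hX c hV.1) hV).add ((θ.smooth' c _ (hX c hV.1)).mul (θ.smooth' c V hV))

/-- Injectivity is pointwise, so it holds on arbitrary sections and restricts to vector fields. -/
theorem flatSections_injective {θ : OneForm E M} {ω : TwoForm E M}
    (h : Function.Injective (flatBundle θ ω)) : Function.Injective (flatSections θ ω) :=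
  fun _ _ hXY => funext fun x => flatBundle_injective_iff.1 h x (congrFun hXY x)

end

end LCGeometry

theorem mainTheorem8
    {E : Type*} [AddCommGroup E] [Module ℝ E] [TopologicalSpace E]
    [IsTopologicalAddGroup E] [ContinuousSMul ℝ E] [LocallyConvexSpace ℝ E] [T2Space E]
    {M : Type*} [TopologicalSpace M] [ChartedSpace E M] [LCGeometry.IsSmoothManifold E M]
    (θ : LCGeometry.OneForm E M) (ω : LCGeometry.TwoForm E M) (hω : ω.IsDegenerate) :
    List.TFAE [
      ∀ x : M, IsCompl (LCGeometry.horizontal θ x) (LCGeometry.vertical ω x),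
      ω.WeaklyNondegenerateOn (LCGeometry.horizontal θ),
      Function.Injective (LCGeometry.flatBundle θ ω)] ∧
    (∀ X : ∀ x : M, LCGeometry.TSpace E x, LCGeometry.IsVectorField E X →
      LCGeometry.IsOneForm E (LCGeometry.flatSections θ ω X)) ∧
    (Function.Injective (LCGeometry.flatBundle θ ω) →
      Set.InjOn (LCGeometry.flatSections θ ω) {X | LCGeometry.IsVectorField E X}) ∧
    (θ.Closed → ω.Closed →
      ((∀ x : M, IsCompl (LCGeometry.horizontal θ x) (LCGeometry.vertical ω x)) ↔
        LCGeometry.IsCosymplectic θ ω)) := by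
  refine ⟨?_, fun X hX => LCGeometry.isOneForm_flatSections θ ω hX,
    fun h => (LCGeometry.flatSections_injective h).injOn,
    fun hθ hω' => ⟨fun h => ⟨⟨hω, h⟩, hθ, hω'⟩, fun h => h.almostContact.splits⟩⟩
  tfae_have 1 ↔ 2 := LCGeometry.splits_iff_weaklyNondegenerateOn hω
  tfae_have 1 ↔ 3 := LCGeometry.splits_iff_flatBundle_injective hω
  tfae_finish
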